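/- Consider the join-the-shortest-queue (JSQ) system with $n\ge 1$ servers, arrival rate $\lambda>0$, service rates $\mu_1,\dots,\mu_n>0$ with total $\mu=\sum_{i=1}^n\mu_i$, and abandonment rate $\gamma>0$. It is the continuous-time Markov chain of queue lengths $\mathbf x\in\mathbb N^n$ that jumps from $\mathbf x$ to $\mathbf x+\mathbf e_*$ at rate $\lambda$, where $*$ is the smallest index $i$ that minimizes $x_i$, and from $\mathbf x$ to $\mathbf x-\mathbf e_i$ at rate $\mu_i+\gamma x_i$ for each $i$ with $x_i\ge 1$. Let $\mathbf q$ be distributed according to a stationary distribution of this chain (a probability measure invariant under its transition semigroup), and let $\mathbf q_\perp=\mathbf q-\frac1n\big(\sum_{i=1}^n q_i\big)\mathbf 1$ be the component of $\mathbf q$ orthogonal to the all-ones vector $\mathbf 1$; $\|\cdot\|$ is the Euclidean norm. Theorem. For all $n\ge1$, $\lambda>0$ and $\mu>0$ there are constants $E^{(1)},E^{(2)},E>0$, depending only on $n,\lambda,\mu$, such that the following holds for all $\mu_1,\dots,\mu_n>0$ with $\sum_i\mu_i=\mu$ and all $\gamma>0$ for which the system is heavily overloaded, that is, for which $$\frac{\lambda}{\mu}-1\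 \ge\ C\Big(\frac{\gamma}{\mu}\Big)^{\alpha}$$ for some constants $C>1$ and $\alpha\in[0,1/2)$. For every real $p\ge1$, $\mathbb E\|\mathbf q_\perp\|^p<\infty$ and $$\mathbb E\big[\|\mathbf q_\perp\|^p\big]^{1/p}\ \le\ \max\{E^{(1)}p^2,\;E^{(2)}p\}\ \le\ E\,p^2 .$$ In particular, the constants do not depend on $p$ or $\gamma$. -/

import Mathlib

open scoped ENNReal
open MeasureTheory

noncomputable section

/-! ### Continuous-time Markov chains on a countable state space -/

namespace CTMC

open Classical in
/-- For jump rates `Q x y` from `x` to `y` (with `Q x x = 0`), the probability that the chain started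
at `x` is at `y` at time `t` after fewer than `k` jumps. The holding time in `x` is exponential with
parameter `∑ z, Q x z`, and `s` below is the time of the first jump. -/
def transitionLT {S : Type*} (Q : S → S → ℝ) : ℕ → ℝ → S → S → ℝ≥0∞
  | 0, _, _, _ => 0
  | k + 1, t, x, y =>
      (if x = y then ENNReal.ofReal (Real.exp (-(∑' z, Q x z) * t)) else 0)
        + ∫⁻ s in Set.Icc (0 : ℝ) t,
            ∑' z, ENNReal.ofReal (Real.exp (-(∑' w, Q x w) * s)) * ENNReal.ofReal (Q x z)
              * transitionLT Q k (t - s) z y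

/-- The transition semigroup `P t x y` of the chain with jump rates `Q`: the minimal nonnegative
solution of the Kolmogorov backward equation (finitely many jumps before time `t`). -/
def transition {S : Type*} (Q : S → S → ℝ) (t : ℝ) (x y : S) : ℝ≥0∞ :=
  ⨆ k, transitionLT Q k t x y

/-- `π` is a stationary distribution of the chain with jump rates `Q`: a probability measure that is
invariant under the transition semigroup. -/
def IsStationary {S : Type*} [MeasurableSpace S] (Q : S → S → ℝ) (π : Measure S) : Prop :=
  IsProbabilityMeasure π ∧
    ∀ t : ℝ, 0 ≤ t → ∀ y : S, ∑' x, π {x} * transition Q t x y = π {y}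

end CTMC

/-! ### Join-the-shortest-queue with abandonment -/

namespace JSQ

/-- The smallest index among the shortest queues. -/
def shortest {n : ℕ} [NeZero n] (x : Fin n → ℕ) : Fin n :=
  (Finset.univ.filter fun i => ∀ j, x i ≤ x j).min' (by
    obtain ⟨i, -, hi⟩ := Finset.exists_min_image Finset.univ x Finset.univ_nonempty
    exact ⟨i, by simpa using hi⟩)

/-- The transition rate kernel: arrivals with rate `lam` join the shortest queue (`y = x + e_*`), and
queue `i` loses a customer (`y = x - e_i ≥ 0`, i.e. `x = y + e_i`) with rate `m i + γ * x i`, by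
service with rate `m i` or by abandonment with rate `γ` per customer. -/
def rate {n : ℕ} [NeZero n] (lam : ℝ) (m : Fin n → ℝ) (γ : ℝ) (x y : Fin n → ℕ) : ℝ :=
  (if y = x + Pi.single (shortest x) 1 then lam else 0)
    + ∑ i, if x = y + Pi.single i 1 then m i + γ * (x i : ℝ) else 0

/-- The component of `x` orthogonal to the all-ones vector, a vector of Euclidean space. -/
def perp {n : ℕ} (x : Fin n → ℕ) : EuclideanSpace ℝ (Fin n) :=
  WithLp.toLp 2 fun i => (x i : ℝ) - (1 / (n : ℝ)) * ∑ j, (x j : ℝ)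

/-- The heavily overloaded condition with constants `C > 1` and `α ∈ [0, 1/2)`, for arrival rate
`lam`, total service rate `mu` and abandonment rate `γ`. -/
def HeavilyOverloaded (C α lam mu γ : ℝ) : Prop :=
  1 < C ∧ 0 ≤ α ∧ α < 1 / 2 ∧ C * (γ / mu) ^ α ≤ lam / mu - 1

end JSQ

end

/-! ### Stationary distributions and the Foster–Lyapunov inequality. -/

namespace CTMC

variable {S : Type*}

/-! Heavy overload enters only through `mu < lam`. Joining the shortest queue then gives the squared
imbalance `‖perp x‖ ^ 2` a drift of at most `-c ‖perp x‖ + Y`, where `c = 2 (lam - mu) / n` and `Y =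
lam + mu + γ * total x`. The constant `c` involves neither `γ` nor the individual service rates, but
`Y` is unbounded.

The total is controlled first: `γ * total x` has exponential moments of every order, uniformly for
`γ ≤ 1` (`lintegral_exp_total_le`). To trade these for moments of the imbalance, take the Lyapunov
function `exp u` with `u = (1 + ‖perp x‖ ^ 2) ^ (1/4)`. Its drift is at most `exp u * (Z / (4 u ^ 2)
- c / (4 u))` with `Z = c + 4 Y`, which is positive only for `u < Z / c`; the excess is therefore at
most an exponential of a multiple of `Y`, which is integrable. Hence `exp (u / 2)` has a bounded
mean (`exists_lintegral_exp_rootPerp_le`). For `γ ≥ 1` the total itself has an exponential moment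
and dominates the imbalance. Since `‖perp x‖ ≤ u ^ 2`, an exponential moment of `u` gives growth `p
^ 2`.

Stationarity is used only as subinvariance under the rates (`IsStationary.sum_mul_rate_le`), which
suffices for the Foster–Lyapunov bound. -/

theorem ofReal_exp_le_transitionLT_one (Q : S → S → ℝ) (t : ℝ) (x : S) :
    ENNReal.ofReal (Real.exp (-(∑' z, Q x z) * t)) ≤ transitionLT Q 1 t x x := by
  simp [transitionLT]

/-- The contribution of at most one jump to the transition probabilities. -/
theorem le_transition {Q : S → S → ℝ} (hQ : ∀ x y, 0 ≤ Q x y) {t : ℝ} (ht : 0 ≤ t) (x y : S)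
    [Decidable (x = y)] :
    ENNReal.ofReal ((if x = y then Real.exp (-(∑' z, Q x z) * t) else 0)
      + t * (Q x y * Real.exp (-((∑' z, Q x z) + ∑' z, Q y z) * t))) ≤ transition Q t x y := by
  -- Index `2` means fewer than two jumps.
  refine le_trans ?_ (le_iSup (fun k => transitionLT Q k t x y) 2)
  have hx : 0 ≤ ∑' z, Q x z := tsum_nonneg (hQ x)
  have hy : 0 ≤ ∑' z, Q y z := tsum_nonneg (hQ y)
  rw [ENNReal.ofReal_add (by split_ifs <;> positivity)
    (mul_nonneg ht (mul_nonneg (hQ x y) (Real.exp_pos _).le))]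
  rw [transitionLT]
  refine add_le_add ?_ ?_
  · by_cases h : x = y <;> simp [h]
  · have key : ∀ s ∈ Set.Icc (0 : ℝ) t,
        ENNReal.ofReal (Q x y * Real.exp (-((∑' z, Q x z) + ∑' z, Q y z) * t)) ≤
        ∑' z, ENNReal.ofReal (Real.exp (-(∑' w, Q x w) * s)) * ENNReal.ofReal (Q x z)
              * transitionLT Q 1 (t - s) z y := by
      intro s hs
      refine le_trans ?_ (ENNReal.le_tsum y)
      refine le_trans ?_ (mul_le_mul_right (ofReal_exp_le_transitionLT_one Q (t - s) y) _)
      rw [← ENNReal.ofReal_mul (Real.exp_pos _).le,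
        ← ENNReal.ofReal_mul (mul_nonneg (Real.exp_pos _).le (hQ x y))]
      apply ENNReal.ofReal_le_ofReal
      have h1 : Real.exp (-((∑' z, Q x z) + ∑' z, Q y z) * t) ≤
          Real.exp (-(∑' w, Q x w) * s) * Real.exp (-(∑' z, Q y z) * (t - s)) := by
        rw [← Real.exp_add]
        apply Real.exp_le_exp.2
        nlinarith [mul_nonneg hx (sub_nonneg.2 hs.2), mul_nonneg hy hs.1]
      calc _ ≤ Q x y * (Real.exp (-(∑' w, Q x w) * s) * Real.exp (-(∑' z, Q y z) * (t - s))) :=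
            mul_le_mul_of_nonneg_left h1 (hQ x y)
        _ = _ := by ring
    calc ENNReal.ofReal (t * (Q x y * Real.exp (-((∑' z, Q x z) + ∑' z, Q y z) * t)))
        = ∫⁻ s in Set.Icc (0 : ℝ) t,
            ENNReal.ofReal (Q x y * Real.exp (-((∑' z, Q x z) + ∑' z, Q y z) * t)) := by
          rw [setLIntegral_const, Real.volume_Icc, sub_zero, mul_comm t,
            ENNReal.ofReal_mul (mul_nonneg (hQ x y) (Real.exp_pos _).le)]
      _ ≤ _ := setLIntegral_mono' measurableSet_Icc key

variable [MeasurableSpace S]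

/-- A stationary distribution is subinvariant for the jump rates. -/
theorem IsStationary.sum_mul_rate_le {Q : S → S → ℝ} (hQ : ∀ x y, 0 ≤ Q x y) {π : Measure S}
    (hπ : IsStationary Q π) (y : S) (F : Finset S) :
    ∑ x ∈ F, π.real {x} * Q x y ≤ π.real {y} * ∑' z, Q y z := by
  classical
  have := hπ.1
  set q : S → ℝ := fun x => ∑' z, Q x z with hq
  have hle : ∀ t : ℝ, 0 < t →
      ∑ x ∈ F, π.real {x} * (Q x y * Real.exp (-(q x + q y) * t)) ≤ π.real {y} * q y := by
    intro t ht
    -- Inserting `y` guarantees that the no-jump term is present; it gives `π {y} * (1 - q y * t)`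
    -- to first order. Dividing by `t` and letting `t → 0` leaves the rates.
    have h1 : ∑ x ∈ insert y F, π {x} * transition Q t x y ≤ π {y} := by
      rw [← hπ.2 t ht.le y]
      exact ENNReal.sum_le_tsum _
    have h2 : ∑ x ∈ insert y F, π.real {x} * ((if x = y then Real.exp (-q x * t) else 0)
        + t * (Q x y * Real.exp (-(q x + q y) * t))) ≤ π.real {y} := by
      have h0 : ∀ x, 0 ≤ (if x = y then Real.exp (-q x * t) else 0)
          + t * (Q x y * Real.exp (-(q x + q y) * t)) := fun x =>
        add_nonneg (by split_ifs <;> positivity)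
          (mul_nonneg ht.le (mul_nonneg (hQ x y) (Real.exp_pos _).le))
      rw [← ENNReal.ofReal_le_ofReal_iff measureReal_nonneg,
        ENNReal.ofReal_sum_of_nonneg (fun x _ => mul_nonneg measureReal_nonneg (h0 x)),
        ofReal_measureReal]
      refine le_trans (Finset.sum_le_sum fun x _ => ?_) h1
      rw [ENNReal.ofReal_mul measureReal_nonneg, ofReal_measureReal]
      exact mul_le_mul_right (le_transition hQ ht.le x y) _
    have h3 : ∑ x ∈ insert y F, π.real {x} * ((if x = y then Real.exp (-q x * t) else 0)
        + t * (Q x y * Real.exp (-(q x + q y) * t))) =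
        π.real {y} * Real.exp (-q y * t) +
        t * ∑ x ∈ insert y F, π.real {x} * (Q x y * Real.exp (-(q x + q y) * t)) := by
      simp_rw [mul_add, Finset.sum_add_distrib]
      congr 1
      · simp [mul_ite]
      · rw [Finset.mul_sum]
        exact Finset.sum_congr rfl fun x _ => by ring
    have h4 : ∑ x ∈ F, π.real {x} * (Q x y * Real.exp (-(q x + q y) * t)) ≤
        ∑ x ∈ insert y F, π.real {x} * (Q x y * Real.exp (-(q x + q y) * t)) :=
      Finset.sum_le_sum_of_subset_of_nonneg (Finset.subset_insert _ _) fun x _ _ =>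
        mul_nonneg measureReal_nonneg (mul_nonneg (hQ x y) (Real.exp_pos _).le)
    have h5 := Real.add_one_le_exp (-q y * t)
    have h6 : 0 ≤ π.real {y} := measureReal_nonneg
    have h7 : t * ∑ x ∈ insert y F, π.real {x} * (Q x y * Real.exp (-(q x + q y) * t)) ≤
        t * (π.real {y} * q y) := by
      nlinarith [mul_le_mul_of_nonneg_left h5 h6]
    exact h4.trans (le_of_mul_le_mul_left h7 ht)
  have hlim : Filter.Tendsto
      (fun t : ℝ => ∑ x ∈ F, π.real {x} * (Q x y * Real.exp (-(q x + q y) * t)))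
      (nhdsWithin 0 (Set.Ioi 0)) (nhds (∑ x ∈ F, π.real {x} * Q x y)) := by
    have hc : Continuous
        (fun t : ℝ => ∑ x ∈ F, π.real {x} * (Q x y * Real.exp (-(q x + q y) * t))) := by
      fun_prop
    simpa using (hc.tendsto 0).mono_left nhdsWithin_le_nhds
  exact le_of_tendsto hlim (Filter.eventually_of_mem self_mem_nhdsWithin fun t ht => hle t ht)

/-- Foster–Lyapunov bound on stationary expectations: if `f` has finite sublevel sets and its drift
is at most `w - g`, then the stationary mean of `g` is at most that of `w`. -/
theorem IsStationary.lintegral_le_of_drift [Countable S] [MeasurableSingletonClass S]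
    {Q : S → S → ℝ} (hQ : ∀ x y, 0 ≤ Q x y) (hfin : ∀ x, (Function.support (Q x)).Finite)
    {π : Measure S} (hπ : IsStationary Q π) {f g w : S → ℝ} (hf : ∀ M, {x | f x < M}.Finite)
    (hg : ∀ x, 0 ≤ g x) (hw : ∀ x, 0 ≤ w x)
    (hd : ∀ x, ∑' y, Q x y * (f y - f x) ≤ w x - g x) :
    ∫⁻ x, ENNReal.ofReal (g x) ∂π ≤ ∫⁻ x, ENNReal.ofReal (w x) ∂π := by
  classical
  have := hπ.1
  have hsum : ∀ (x : S) (h : S → ℝ), Summable fun y => Q x y * h y := fun x h =>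
    summable_of_hasFiniteSupport ((hfin x).subset fun y hy => left_ne_zero_of_mul hy)
  have key : ∀ M, ∑ x ∈ (hf M).toFinset, π.real {x} * g x ≤
      ∑ x ∈ (hf M).toFinset, π.real {x} * w x := by
    intro M
    set A := (hf M).toFinset with hA
    have hmem : ∀ x, x ∈ A ↔ f x < M := fun x => by simp [hA]
    -- Subinvariance is tested against the positive part of `M - f`, which is finitely supported, so
    -- integrability of `f` is never needed.
    have h1 : ∑ y ∈ A, (M - f y) * ∑ x ∈ A, π.real {x} * Q x y ≤
        ∑ y ∈ A, (M - f y) * (π.real {y} * ∑' z, Q y z) :=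
      Finset.sum_le_sum fun y hy => mul_le_mul_of_nonneg_left (hπ.sum_mul_rate_le hQ y A)
        (sub_nonneg.2 ((hmem y).1 hy).le)
    have h2 : ∑ y ∈ A, (M - f y) * ∑ x ∈ A, π.real {x} * Q x y =
        ∑ x ∈ A, π.real {x} * ∑ y ∈ A, Q x y * (M - f y) := by
      simp_rw [Finset.mul_sum]
      rw [Finset.sum_comm]
      exact Finset.sum_congr rfl fun x _ => Finset.sum_congr rfl fun y _ => by ring
    have h3 : ∀ x ∈ A, π.real {x} * (∑ y ∈ A, Q x y * (M - f y)) ≥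
        π.real {x} * g x - π.real {x} * w x + (M - f x) * (π.real {x} * ∑' z, Q x z) := by
      intro x hx
      have e1 : ∑' y, Q x y * (M - f y) ≤ ∑ y ∈ A, Q x y * (M - f y) := by
        -- Jumps out of `A` only help: there `M - f y ≤ 0` is replaced by `0`.
        refine le_trans ((hsum x _).tsum_le_tsum (g := fun y => Q x y * max (M - f y) 0)
          (fun y => mul_le_mul_of_nonneg_left (le_max_left _ _) (hQ x y)) (hsum x _)) ?_
        rw [tsum_eq_sum (s := A)]
        · refine Finset.sum_le_sum fun y hy => ?_
          rw [max_eq_left (sub_nonneg.2 ((hmem y).1 hy).le)]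
        · intro y hy
          rw [max_eq_right (sub_nonpos.2 (not_lt.1 fun h => hy ((hmem y).2 h))), mul_zero]
      have e2 : ∑' y, Q x y * (M - f y) =
          (M - f x) * (∑' z, Q x z) - ∑' y, Q x y * (f y - f x) := by
        rw [← tsum_mul_left, ← Summable.tsum_sub _ (hsum x _)]
        · exact tsum_congr fun y => by ring
        · exact (hsum x fun _ => M - f x).congr fun y => by ring
      have e3 := hd x
      have e4 : g x - w x + (M - f x) * ∑' z, Q x z ≤ ∑ y ∈ A, Q x y * (M - f y) := by
        linarith
      calc _ ≥ π.real {x} * (g x - w x + (M - f x) * ∑' z, Q x z) :=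
            mul_le_mul_of_nonneg_left e4 measureReal_nonneg
        _ = _ := by ring
    have h4 := Finset.sum_le_sum h3
    rw [Finset.sum_add_distrib, Finset.sum_sub_distrib] at h4
    linarith
  have hr : ∀ (h : S → ℝ), (∀ x, 0 ≤ h x) → ∀ A : Finset S,
      ENNReal.ofReal (∑ x ∈ A, π.real {x} * h x) =
        ∑ x ∈ A, ENNReal.ofReal (h x) * π {x} := by
    intro h hh A
    rw [ENNReal.ofReal_sum_of_nonneg fun x _ => mul_nonneg measureReal_nonneg (hh x)]
    refine Finset.sum_congr rfl fun x _ => ?_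
    rw [ENNReal.ofReal_mul measureReal_nonneg, ofReal_measureReal, mul_comm]
  rw [lintegral_countable', lintegral_countable', ENNReal.tsum_eq_iSup_sum]
  refine iSup_le fun B => ?_
  obtain ⟨M, hM⟩ : ∃ M, ∀ x ∈ B, f x < M := by
    obtain ⟨M, hM⟩ := (B.image f).bddAbove
    exact ⟨M + 1, fun x hx => lt_of_le_of_lt
      (hM (by simpa using ⟨x, hx, rfl⟩)) (lt_add_one M)⟩
  calc ∑ x ∈ B, ENNReal.ofReal (g x) * π {x}
      ≤ ∑ x ∈ (hf M).toFinset, ENNReal.ofReal (g x) * π {x} :=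
        Finset.sum_le_sum_of_subset fun x hx => by simpa using hM x hx
    _ ≤ ∑ x ∈ (hf M).toFinset, ENNReal.ofReal (w x) * π {x} := by
        rw [← hr g hg, ← hr w hw]
        exact ENNReal.ofReal_le_ofReal (key M)
    _ ≤ _ := ENNReal.sum_le_tsum _

end CTMC

/-! ### The JSQ generator and the total queue length. -/

namespace JSQ

variable {n : ℕ}

/-- The departure rate of queue `i`. -/
noncomputable def departure (m : Fin n → ℝ) (γ : ℝ) (x : Fin n → ℕ) (i : Fin n) : ℝ :=
  if 1 ≤ x i then m i + γ * x i else 0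

/-- The total number of customers. -/
def total (x : Fin n → ℕ) : ℝ := ∑ i, (x i : ℝ)

theorem total_nonneg (x : Fin n → ℕ) : 0 ≤ total x :=
  Finset.sum_nonneg fun i _ => Nat.cast_nonneg (x i)

theorem total_add_single (x : Fin n → ℕ) (i : Fin n) :
    total (x + Pi.single i 1) = total x + 1 := by
  have h : ∀ j, ((Pi.single i 1 : Fin n → ℕ) j : ℝ) = if j = i then 1 else 0 := fun j => by
    by_cases h : j = i <;> simp [h]
  simp [total, Finset.sum_add_distrib, h]

theorem sub_single_add_single {x : Fin n → ℕ} {i : Fin n} (hi : 1 ≤ x i) :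
    x - Pi.single i 1 + Pi.single i 1 = x := by
  ext j
  by_cases h : j = i
  · subst h; simp; omega
  · simp [h]

theorem total_sub_single {x : Fin n → ℕ} {i : Fin n} (hi : 1 ≤ x i) :
    total (x - Pi.single i 1) = total x - 1 := by
  rw [eq_sub_iff_add_eq, ← total_add_single _ i, sub_single_add_single hi]

theorem finite_of_mul_total_le {f : (Fin n → ℕ) → ℝ} {c : ℝ} (hc : 0 < c)
    (h : ∀ x, c * total x ≤ f x) (M : ℝ) : {x | f x < M}.Finite := by
  refine (Set.finite_Iic fun _ : Fin n => ⌈M / c⌉₊).subset fun x hx i => ?_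
  have h1 : (x i : ℝ) ≤ total x :=
    Finset.single_le_sum (f := fun i => (x i : ℝ)) (fun j _ => Nat.cast_nonneg _)
      (Finset.mem_univ i)
  have h2 : total x ≤ M / c := by
    rw [le_div_iff₀ hc]
    have := h x
    have hx' : f x < M := hx
    linarith
  exact_mod_cast (h1.trans h2).trans (Nat.le_ceil _)

theorem departure_nonneg {m : Fin n → ℝ} {γ : ℝ} (hm : ∀ i, 0 < m i) (hγ : 0 < γ)
    (x : Fin n → ℕ) (i : Fin n) : 0 ≤ departure m γ x i := by
  unfold departure
  split_ifs
  · have := hm i; positivity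
  · rfl

theorem departure_le {m : Fin n → ℝ} {γ : ℝ} (hm : ∀ i, 0 < m i) (hγ : 0 < γ)
    (x : Fin n → ℕ) (i : Fin n) : departure m γ x i ≤ m i + γ * x i := by
  unfold departure
  split_ifs
  · rfl
  · have := hm i; positivity

theorem mul_le_departure {m : Fin n → ℝ} {γ : ℝ} (hm : ∀ i, 0 < m i)
    (x : Fin n → ℕ) (i : Fin n) : γ * x i ≤ departure m γ x i := by
  unfold departure
  split_ifs with h
  · have := hm i; linarith
  · have : x i = 0 := by omega
    simp [this]

theorem mul_total_le_sum_departure {m : Fin n → ℝ} {γ : ℝ} (hm : ∀ i, 0 < m i)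
    (x : Fin n → ℕ) : γ * total x ≤ ∑ i, departure m γ x i := by
  rw [total, Finset.mul_sum]
  exact Finset.sum_le_sum fun i _ => mul_le_departure hm x i

theorem sum_departure_le {m : Fin n → ℝ} {γ : ℝ} (hm : ∀ i, 0 < m i) (hγ : 0 < γ)
    (x : Fin n → ℕ) : ∑ i, departure m γ x i ≤ ∑ i, m i + γ * total x := by
  rw [total, Finset.mul_sum, ← Finset.sum_add_distrib]
  exact Finset.sum_le_sum fun i _ => departure_le hm hγ x i

variable [NeZero n]

theorem shortest_le (x : Fin n → ℕ) (j : Fin n) : x (shortest x) ≤ x j := by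
  have h := Finset.min'_mem (Finset.univ.filter fun i => ∀ j, x i ≤ x j) (by
    obtain ⟨i, -, hi⟩ := Finset.exists_min_image Finset.univ x Finset.univ_nonempty
    exact ⟨i, by simpa using hi⟩)
  exact (Finset.mem_filter.1 h).2 j

theorem rate_nonneg {lam : ℝ} {m : Fin n → ℝ} {γ : ℝ} (hlam : 0 < lam) (hm : ∀ i, 0 < m i)
    (hγ : 0 < γ) (x y : Fin n → ℕ) : 0 ≤ rate lam m γ x y := by
  refine add_nonneg (by split_ifs <;> positivity) (Finset.sum_nonneg fun i _ => ?_)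
  have := hm i
  split_ifs <;> positivity

/-- The truncated subtraction is harmless: at an empty queue `x - Pi.single i 1 = x`, but the
departure rate vanishes. -/
theorem rate_eq (lam : ℝ) (m : Fin n → ℝ) (γ : ℝ) (x y : Fin n → ℕ) :
    rate lam m γ x y = (if y = x + Pi.single (shortest x) 1 then lam else 0)
      + ∑ i, if y = x - Pi.single i 1 then departure m γ x i else 0 := by
  unfold rate departure
  congr 1
  refine Finset.sum_congr rfl fun i _ => ?_
  by_cases hi : 1 ≤ x i
  · have : x = y + Pi.single i 1 ↔ y = x - Pi.single i 1 := by
      constructor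
      · rintro rfl; simp
      · rintro rfl; exact (sub_single_add_single hi).symm
    simp only [this, hi, if_true]
  · have : ¬ x = y + Pi.single i 1 := by
      intro h
      apply hi
      rw [h]; simp
    simp [this, hi]

theorem hasSum_rate_mul (lam : ℝ) (m : Fin n → ℝ) (γ : ℝ) (x : Fin n → ℕ)
    (h : (Fin n → ℕ) → ℝ) :
    HasSum (fun y => rate lam m γ x y * h y) (lam * h (x + Pi.single (shortest x) 1)
      + ∑ i, departure m γ x i * h (x - Pi.single i 1)) := by
  simp_rw [rate_eq, add_mul, Finset.sum_mul, ite_mul, zero_mul]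
  have aux : ∀ (z : Fin n → ℕ) (c : ℝ), HasSum (fun y => if y = z then c * h y else 0) (c * h z) := by
    intro z c
    convert hasSum_ite_eq z (c * h z) using 2 with y
    by_cases hy : y = z <;> simp [hy]
  exact (aux _ _).add (hasSum_sum fun i _ => aux _ _)

theorem finite_support_rate (lam : ℝ) (m : Fin n → ℝ) (γ : ℝ) (x : Fin n → ℕ) :
    (Function.support (rate lam m γ x)).Finite := by
  refine ((Set.finite_singleton (x + Pi.single (shortest x) 1)).union
    (Set.finite_range fun i => x - Pi.single i 1)).subset fun y hy => ?_
  by_contra hn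
  simp only [Set.mem_union, Set.mem_singleton_iff, Set.mem_range, not_or, not_exists] at hn
  apply hy
  rw [rate_eq, if_neg hn.1, zero_add]
  exact Finset.sum_eq_zero fun i _ => if_neg fun h => hn.2 i h.symm

/-- Foster–Lyapunov bound for the JSQ chain, with the drift written out. -/
theorem lintegral_le_of_drift {lam : ℝ} {m : Fin n → ℝ} {γ : ℝ} (hlam : 0 < lam)
    (hm : ∀ i, 0 < m i) (hγ : 0 < γ) {π : Measure (Fin n → ℕ)}
    (hπ : CTMC.IsStationary (rate lam m γ) π) {f g w : (Fin n → ℕ) → ℝ} {c : ℝ} (hc : 0 < c)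
    (hf : ∀ x, c * total x ≤ f x) (hg : ∀ x, 0 ≤ g x) (hw : ∀ x, 0 ≤ w x)
    (hd : ∀ x, lam * (f (x + Pi.single (shortest x) 1) - f x)
      + ∑ i, departure m γ x i * (f (x - Pi.single i 1) - f x) ≤ w x - g x) :
    ∫⁻ x, ENNReal.ofReal (g x) ∂π ≤ ∫⁻ x, ENNReal.ofReal (w x) ∂π :=
  hπ.lintegral_le_of_drift (rate_nonneg hlam hm hγ) (finite_support_rate lam m γ)
    (finite_of_mul_total_le hc hf) hg hw fun x => by
      rw [(hasSum_rate_mul lam m γ x fun y => f y - f x).tsum_eq]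
      exact hd x

/-- Exponential moments of the scaled total queue length, uniformly in the abandonment rate. -/
theorem lintegral_exp_total_le {lam : ℝ} {m : Fin n → ℝ} {γ : ℝ} (hlam : 0 < lam)
    (hm : ∀ i, 0 < m i) (hγ : 0 < γ) {π : Measure (Fin n → ℕ)}
    (hπ : CTMC.IsStationary (rate lam m γ) π) {a : ℝ} (ha : 0 < a) :
    ∫⁻ x, ENNReal.ofReal (Real.exp (a * min γ 1 * total x)) ∂π ≤
      ENNReal.ofReal ((1 + lam * Real.exp a) *
        Real.exp (a * ((lam * Real.exp a + 1) * Real.exp a))) := by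
  have := hπ.1
  set z := a * min γ 1 with hz
  have hg0 : 0 < min γ 1 := lt_min hγ one_pos
  have hz0 : 0 < z := mul_pos ha hg0
  have hza : z ≤ a := by
    have := min_le_right γ 1
    nlinarith
  set K := (1 + lam * Real.exp a) *
        Real.exp (a * ((lam * Real.exp a + 1) * Real.exp a)) with hK
  have hK0 : 0 < K := by positivity
  have hu : Real.exp z - 1 ≤ z * Real.exp a := by
    have h1 := Real.one_sub_le_exp_neg z
    have h2 : Real.exp z * Real.exp (-z) = 1 := by rw [← Real.exp_add]; simp
    have h3 := Real.exp_le_exp.2 hza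
    nlinarith [Real.exp_pos z]
  have hl : z * Real.exp (-a) ≤ 1 - Real.exp (-z) := by
    have h1 := Real.add_one_le_exp z
    have h2 : Real.exp z * Real.exp (-z) = 1 := by rw [← Real.exp_add]; simp
    have h3 : Real.exp (-a) ≤ Real.exp (-z) := Real.exp_le_exp.2 (by linarith)
    nlinarith [Real.exp_pos (-z)]
  have hd : ∀ x : Fin n → ℕ,
      lam * (Real.exp (z * total (x + Pi.single (shortest x) 1)) - Real.exp (z * total x))
      + ∑ i, departure m γ x i * (Real.exp (z * total (x - Pi.single i 1))
          - Real.exp (z * total x)) ≤ z * K - z * Real.exp (z * total x) := by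
    intro x
    set f := Real.exp (z * total x) with hf
    have hf0 : 0 < f := Real.exp_pos _
    have e1 : Real.exp (z * total (x + Pi.single (shortest x) 1)) = f * Real.exp z := by
      rw [total_add_single, hf, ← Real.exp_add]; congr 1; ring
    have e2 : ∀ i, departure m γ x i * (Real.exp (z * total (x - Pi.single i 1)) - f) =
        departure m γ x i * (f * (Real.exp (-z) - 1)) := by
      intro i
      by_cases hi : 1 ≤ x i
      · rw [total_sub_single hi, show z * (total x - 1) = z * total x + -z by ring, Real.exp_add]
        ring
      · simp [departure, hi]
    rw [e1, Finset.sum_congr rfl fun i _ => e2 i, ← Finset.sum_mul]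
    have h3 : min γ 1 * total x ≤ ∑ i, departure m γ x i :=
      le_trans (mul_le_mul_of_nonneg_right (min_le_left _ _) (total_nonneg x))
        (mul_total_le_sum_departure hm x)
    set s := min γ 1 * total x with hs
    have hs0 : 0 ≤ s := mul_nonneg hg0.le (total_nonneg x)
    have h4 : (∑ i, departure m γ x i) * (1 - Real.exp (-z)) ≥ s * (z * Real.exp (-a)) :=
      mul_le_mul h3 hl (by positivity) (hs0.trans h3)
    have h5 : lam * (f * Real.exp z - f) + (∑ i, departure m γ x i) * (f * (Real.exp (-z) - 1))
        ≤ z * (f * (lam * Real.exp a - s * Real.exp (-a))) := by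
      have h6 : lam * (Real.exp z - 1) ≤ lam * (z * Real.exp a) :=
        mul_le_mul_of_nonneg_left hu hlam.le
      have h7 : f * (lam * (Real.exp z - 1) - (∑ i, departure m γ x i) * (1 - Real.exp (-z))) ≤
          f * (lam * (z * Real.exp a) - s * (z * Real.exp (-a))) :=
        mul_le_mul_of_nonneg_left (by linarith) hf0.le
      linarith
    refine h5.trans ?_
    rw [← mul_sub]
    refine mul_le_mul_of_nonneg_left ?_ hz0.le
    have h8 : Real.exp a * Real.exp (-a) = 1 := by rw [← Real.exp_add]; simp
    have ea := Real.exp_pos (-a)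
    -- Above this threshold for `s` the bracket `lam * exp a - s * exp (-a)` is at most `-1`; below
    -- it `f = exp (a * s)` is bounded. The factor `z`, the only source of small `γ`, cancels at the
    -- end.
    by_cases hB : (lam * Real.exp a + 1) * Real.exp a ≤ s
    · have : lam * Real.exp a + 1 ≤ s * Real.exp (-a) := by
        calc lam * Real.exp a + 1 = (lam * Real.exp a + 1) * Real.exp a * Real.exp (-a) := by
              rw [mul_assoc, h8, mul_one]
          _ ≤ _ := mul_le_mul_of_nonneg_right hB ea.le
      nlinarith
    · have h9 : f ≤ Real.exp (a * ((lam * Real.exp a + 1) * Real.exp a)) := by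
        apply Real.exp_le_exp.2
        have : z * total x = a * s := by rw [hz, hs]; ring
        rw [this]
        exact mul_le_mul_of_nonneg_left (not_le.1 hB).le ha.le
      have h10 : (1 + lam * Real.exp a) * f ≤ K :=
        mul_le_mul_of_nonneg_left h9 (by positivity)
      nlinarith [mul_nonneg hf0.le (mul_nonneg hs0 ea.le)]
  have main := lintegral_le_of_drift hlam hm hγ hπ (f := fun x => Real.exp (z * total x))
    (g := fun x => z * Real.exp (z * total x)) (w := fun _ => z * K) hz0
    (fun x => by have := Real.add_one_le_exp (z * total x); linarith)
    (fun x => by positivity) (fun x => by positivity) hd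
  simp_rw [ENNReal.ofReal_mul hz0.le] at main
  rw [lintegral_const, measure_univ, mul_one, lintegral_const_mul' _ _ ENNReal.ofReal_ne_top]
    at main
  exact (ENNReal.mul_le_mul_iff_right (by simpa using hz0) ENNReal.ofReal_ne_top).1 main

end JSQ

/-! ### The imbalance, its smoothed root and its drift. -/

namespace JSQ

variable {n : ℕ}

theorem sum_eq_total (x : Fin n → ℕ) : ∑ i, (x i : ℝ) = total x := rfl

theorem perp_apply (x : Fin n → ℕ) (i : Fin n) : perp x i = (x i : ℝ) - total x / n := by
  simp [perp, total, div_eq_inv_mul]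

theorem norm_perp_sq (x : Fin n → ℕ) : ‖perp x‖ ^ 2 = ∑ i, ((x i : ℝ) - total x / n) ^ 2 := by
  simp [EuclideanSpace.norm_sq_eq, perp_apply]

theorem abs_sub_le_norm_perp (x : Fin n → ℕ) (i : Fin n) :
    |(x i : ℝ) - total x / n| ≤ ‖perp x‖ := by
  have := PiLp.norm_apply_le (perp x) i
  rwa [perp_apply, Real.norm_eq_abs] at this

/-- A smoothed square root of the imbalance. -/
noncomputable def rootPerp (x : Fin n → ℕ) : ℝ := √√(1 + ‖perp x‖ ^ 2)

theorem rootPerp_pow_four (x : Fin n → ℕ) : rootPerp x ^ 4 = 1 + ‖perp x‖ ^ 2 := by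
  rw [rootPerp, show (4 : ℕ) = 2 * 2 by rfl, pow_mul, Real.sq_sqrt (Real.sqrt_nonneg _),
    Real.sq_sqrt (by positivity)]

theorem one_le_rootPerp (x : Fin n → ℕ) : 1 ≤ rootPerp x := by
  rw [rootPerp, Real.one_le_sqrt, Real.one_le_sqrt]
  have := sq_nonneg ‖perp x‖
  linarith

theorem norm_perp_le_rootPerp_sq (x : Fin n → ℕ) : ‖perp x‖ ≤ rootPerp x ^ 2 := by
  refine le_of_sq_le_sq ?_ (by positivity)
  have := rootPerp_pow_four x
  nlinarith

theorem rootPerp_sq_sub_one_le (x : Fin n → ℕ) : rootPerp x ^ 2 - 1 ≤ ‖perp x‖ := by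
  have h := rootPerp_pow_four x
  have h1 := one_le_rootPerp x
  have h0 := norm_nonneg (perp x)
  by_contra! hc
  nlinarith

/-- The scale `4 * p` in `u ≤ 4 p exp (u / (4 p))` is chosen so that squaring and taking the `p`-th
power leaves exactly `exp (u / 2)`, whatever `p` is. -/
theorem norm_perp_rpow_le (x : Fin n → ℕ) {p : ℝ} (hp : 1 ≤ p) :
    ‖perp x‖ ^ p ≤ (16 * p ^ 2) ^ p * Real.exp (rootPerp x / 2) := by
  have hp0 : 0 < p := by linarith
  have hu1 := one_le_rootPerp x
  set u := rootPerp x with hu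
  have h1 : u ≤ 4 * p * Real.exp (u / (4 * p)) := by
    have h := Real.add_one_le_exp (u / (4 * p))
    calc u = 4 * p * (u / (4 * p)) := by field_simp
      _ ≤ _ := mul_le_mul_of_nonneg_left (by linarith) (by positivity)
  calc ‖perp x‖ ^ p ≤ ((4 * p * Real.exp (u / (4 * p))) ^ 2) ^ p := by
        refine Real.rpow_le_rpow (norm_nonneg _) ?_ hp0.le
        exact (norm_perp_le_rootPerp_sq x).trans (pow_le_pow_left₀ (by linarith) h1 2)
    _ = (16 * p ^ 2 * Real.exp (u / (2 * p))) ^ p := by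
        congr 1
        rw [mul_pow, ← Real.exp_nat_mul]
        congr 1
        · ring
        · congr 1; field_simp; norm_num
    _ = _ := by
        rw [Real.mul_rpow (by positivity) (Real.exp_pos _).le, ← Real.exp_mul]
        congr 2; field_simp

/-- The fourth root lies below its tangent, so `v ≤ u + z`, and `exp z ≤ 1 + z + z ^ 2` for `|z| ≤
1`. The bound on `d` fits a single jump, which changes `‖perp x‖ ^ 2` by at most `2 u ^ 2 + 1`. -/
theorem exp_sub_exp_le {u v d : ℝ} (hu : 1 ≤ u) (hv : 0 ≤ v) (hd : v ^ 4 = u ^ 4 + d)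
    (hd' : |d| ≤ 3 * u ^ 2) :
    Real.exp v - Real.exp u ≤ Real.exp u * (d / (4 * u ^ 3) + 9 / (16 * u ^ 2)) := by
  have hu0 : 0 < u := by linarith
  set z := d / (4 * u ^ 3) with hz
  have h1 : v ≤ u + z := by
    have : (v - u) * (4 * u ^ 3) ≤ d := by
      have : 0 ≤ (v - u) ^ 2 * (v ^ 2 + 2 * v * u + 3 * u ^ 2) := by positivity
      nlinarith
    have := (le_div_iff₀ (by positivity)).2 this
    linarith
  have h2 : |z| ≤ 3 / (4 * u) := by
    rw [hz, abs_div, abs_of_pos (show 0 < 4 * u ^ 3 by positivity),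
      div_le_div_iff₀ (by positivity) (by positivity)]
    nlinarith
  have h3 : |z| ≤ 1 := h2.trans (by rw [div_le_one (by positivity)]; linarith)
  have h4 := (abs_le.1 (Real.abs_exp_sub_one_sub_id_le h3)).2
  have h5 : z ^ 2 ≤ 9 / (16 * u ^ 2) := by
    rw [← sq_abs]
    calc |z| ^ 2 ≤ (3 / (4 * u)) ^ 2 := pow_le_pow_left₀ (abs_nonneg z) h2 2
      _ = _ := by rw [div_pow, mul_pow]; norm_num
  have h6 : Real.exp v ≤ Real.exp u * Real.exp z := by
    rw [← Real.exp_add]; exact Real.exp_le_exp.2 h1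
  nlinarith [Real.exp_pos u]

variable [NeZero n]

theorem sum_sub_mean (x : Fin n → ℕ) : ∑ i, ((x i : ℝ) - total x / n) = 0 := by
  have : (n : ℝ) ≠ 0 := Nat.cast_ne_zero.2 (NeZero.ne n)
  simp only [Finset.sum_sub_distrib, Finset.sum_const, Finset.card_univ, Fintype.card_fin,
    nsmul_eq_mul, sum_eq_total]
  field_simp
  ring

theorem norm_perp_sq_eq (x : Fin n → ℕ) :
    ‖perp x‖ ^ 2 = ∑ i, (x i : ℝ) ^ 2 - total x ^ 2 / n := by
  have : (n : ℝ) ≠ 0 := Nat.cast_ne_zero.2 (NeZero.ne n)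
  have h : ∀ i, ((x i : ℝ) - total x / n) ^ 2 =
      (x i : ℝ) ^ 2 - 2 * (total x / n) * x i + (total x / n) ^ 2 := fun i => by ring
  rw [norm_perp_sq]
  simp only [h, Finset.sum_add_distrib, Finset.sum_sub_distrib, ← Finset.mul_sum,
    Finset.sum_const, Finset.card_univ, Fintype.card_fin, nsmul_eq_mul, sum_eq_total]
  field_simp
  ring

theorem norm_perp_sq_add_single (x : Fin n → ℕ) (i : Fin n) :
    ‖perp (x + Pi.single i 1)‖ ^ 2 =
      ‖perp x‖ ^ 2 + (2 * ((x i : ℝ) - total x / n) + 1 - 1 / n) := by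
  have : (n : ℝ) ≠ 0 := Nat.cast_ne_zero.2 (NeZero.ne n)
  have h : ∀ j, (((x + Pi.single i 1 : Fin n → ℕ) j : ℕ) : ℝ) ^ 2 =
      (x j : ℝ) ^ 2 + if j = i then 2 * (x i : ℝ) + 1 else 0 := fun j => by
    by_cases h : j = i
    · subst h; simp; ring
    · simp [h]
  rw [norm_perp_sq_eq, norm_perp_sq_eq, total_add_single]
  simp only [h, Finset.sum_add_distrib, Finset.sum_ite_eq', Finset.mem_univ, if_true]
  field_simp
  ring

theorem norm_perp_sq_sub_single {x : Fin n → ℕ} {i : Fin n} (hi : 1 ≤ x i) :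
    ‖perp (x - Pi.single i 1)‖ ^ 2 =
      ‖perp x‖ ^ 2 + (-(2 * ((x i : ℝ) - total x / n)) + 1 - 1 / n) := by
  have h := norm_perp_sq_add_single (x - Pi.single i 1) i
  rw [sub_single_add_single hi, total_sub_single hi] at h
  have h2 : (((x - Pi.single i 1 : Fin n → ℕ) i : ℕ) : ℝ) = (x i : ℝ) - 1 := by
    simp [Nat.cast_sub hi]
  rw [h, h2]
  ring

theorem norm_perp_le_total (x : Fin n → ℕ) : ‖perp x‖ ≤ total x := by
  refine le_of_sq_le_sq ?_ (total_nonneg x)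
  rw [norm_perp_sq_eq]
  have h1 : ∑ i, (x i : ℝ) ^ 2 ≤ total x ^ 2 :=
    Finset.sum_sq_le_sq_sum_of_nonneg fun i _ => Nat.cast_nonneg _
  have : 0 ≤ total x ^ 2 / n := by positivity
  linarith

/-- The shortest queue lies below the mean by a fixed fraction of the imbalance. -/
theorem norm_perp_le_mean_sub_shortest (x : Fin n → ℕ) :
    ‖perp x‖ ≤ n * (total x / n - x (shortest x)) := by
  have hn : (n : ℝ) ≠ 0 := Nat.cast_ne_zero.2 (NeZero.ne n)
  set a : ℝ := ((x (shortest x) : ℕ) : ℝ) with ha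
  have h0 : ∀ i, 0 ≤ (x i : ℝ) - a := fun i =>
    sub_nonneg.2 (by rw [ha]; exact_mod_cast shortest_le x i)
  have h1 : ∑ i, ((x i : ℝ) - a) = n * (total x / n - a) := by
    simp only [Finset.sum_sub_distrib, Finset.sum_const, Finset.card_univ, Fintype.card_fin,
      nsmul_eq_mul, sum_eq_total]
    field_simp
  rw [← h1]
  refine le_of_sq_le_sq ?_ (Finset.sum_nonneg fun i _ => h0 i)
  -- Gaps above the minimum are nonnegative, so their sum dominates their Euclidean norm; recentring
  -- at the mean only decreases the sum of squares.
  refine le_trans ?_ (Finset.sum_sq_le_sq_sum_of_nonneg fun i _ => h0 i)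
  have h2 : ∀ i, ((x i : ℝ) - a) ^ 2 = ((x i : ℝ) - total x / n) ^ 2 +
      2 * (total x / n - a) * ((x i : ℝ) - total x / n) + (total x / n - a) ^ 2 := fun i => by ring
  simp only [h2, Finset.sum_add_distrib, ← Finset.mul_sum, sum_sub_mean, ← norm_perp_sq]
  have : 0 ≤ ∑ _i : Fin n, (total x / n - a) ^ 2 := Finset.sum_nonneg fun i _ => sq_nonneg _
  linarith

/-- The drift of the squared imbalance. -/
theorem drift_norm_perp_sq_le {lam : ℝ} {m : Fin n → ℝ} {γ : ℝ} (hlam : 0 < lam)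
    (hm : ∀ i, 0 < m i) (hγ : 0 < γ) (hov : ∑ i, m i < lam) (x : Fin n → ℕ) :
    lam * (2 * ((x (shortest x) : ℝ) - total x / n) + 1 - 1 / n)
      + ∑ i, departure m γ x i * (-(2 * ((x i : ℝ) - total x / n)) + 1 - 1 / n) ≤
    -(2 * (lam - ∑ i, m i) / n * ‖perp x‖) + (lam + ∑ i, departure m γ x i) := by
  have hn : (0 : ℝ) < n := Nat.cast_pos.2 (NeZero.pos n)
  set A := total x / n with hA
  set a : ℝ := ((x (shortest x) : ℕ) : ℝ) with ha
  have h1 : ∀ i, departure m γ x i * (-(2 * ((x i : ℝ) - A)) + 1 - 1 / n) ≤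
      -2 * (m i * (a - A)) - 2 * γ * ((x i : ℝ) - A) ^ 2 - 2 * γ * A * ((x i : ℝ) - A)
        + departure m γ x i := by
    intro i
    have hd := departure_nonneg hm hγ x i
    have hA0 : 0 ≤ A := div_nonneg (total_nonneg x) hn.le
    have hmi := hm i
    -- The two rates differ only at an empty queue, which is not above the mean. Abandonment then
    -- splits by `x i = (x i - A) + A`: a favourable square, and a term summing to zero.
    have e1 : (m i + γ * x i) * ((x i : ℝ) - A) ≤ departure m γ x i * ((x i : ℝ) - A) := by
      unfold departure
      split_ifs with h
      · rfl
      · have : x i = 0 := by omega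
        simp [this]
        positivity
    -- The worst case puts all service at the shortest queue, so only `∑ i, m i` survives and
    -- arrivals win by `lam - ∑ i, m i`.
    have e2 : m i * (a - A) ≤ m i * ((x i : ℝ) - A) := by
      refine mul_le_mul_of_nonneg_left ?_ hmi.le
      have : a ≤ x i := by rw [ha]; exact_mod_cast shortest_le x i
      linarith
    have e3 : 0 ≤ departure m γ x i * (1 / n) := by positivity
    nlinarith
  have h2 := Finset.sum_le_sum fun i (_ : i ∈ Finset.univ) => h1 i
  rw [Finset.sum_add_distrib, Finset.sum_sub_distrib, Finset.sum_sub_distrib, ← Finset.mul_sum,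
    ← Finset.mul_sum, ← Finset.mul_sum, ← Finset.sum_mul, sum_sub_mean, ← norm_perp_sq] at h2
  have h3 := norm_perp_le_mean_sub_shortest x
  have h4 : 2 * (lam - ∑ i, m i) / n * ‖perp x‖ ≤ 2 * (lam - ∑ i, m i) * (A - a) := by
    rw [div_mul_eq_mul_div, div_le_iff₀ hn]
    have : 0 ≤ 2 * (lam - ∑ i, m i) := by linarith
    nlinarith [mul_le_mul_of_nonneg_left h3 this]
  have h5 : 0 ≤ γ * ‖perp x‖ ^ 2 := by positivity
  have h6 : 0 ≤ lam * (1 / n) := by positivity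
  nlinarith

end JSQ

/-! ### Exponential moments of the root of the imbalance. -/

namespace JSQ

variable {n : ℕ} [NeZero n]

/-- Half of the negative term absorbs `Z` once `2 * Z ≤ c * u`; otherwise `u ≤ 2 * Z / c` bounds
everything by an exponential of `Z`. The other half yields `exp (u / 2)`, as `exp (u / 2) ≥ u / 2`.
-/
theorem exp_mul_sub_le {c Z u : ℝ} (hc : 0 < c) (hZ : 0 < Z) (hu : 1 ≤ u) :
    Real.exp u * (Z / (4 * u ^ 2) - c / (4 * u)) ≤
      Real.exp ((1 + 2 / c) * Z) - c / 16 * Real.exp (u / 2) := by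
  have hu0 : 0 < u := by linarith
  have h1 : Real.exp (u / 2) / 2 ≤ Real.exp u / u := by
    rw [div_le_div_iff₀ two_pos hu0]
    have h2 := Real.add_one_le_exp (u / 2)
    have h3 : Real.exp u = Real.exp (u / 2) * Real.exp (u / 2) := by
      rw [← Real.exp_add]; congr 1; ring
    rw [h3]
    nlinarith [Real.exp_pos (u / 2)]
  have h2 : Real.exp u * (Z / (4 * u ^ 2) - c / (4 * u)) ≤
      Z * Real.exp (2 / c * Z) - c / 8 * (Real.exp u / u) := by
    have e : Real.exp u * (Z / (4 * u ^ 2) - c / (4 * u)) =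
        Real.exp u / u ^ 2 * ((2 * Z - c * u) / 8) - c / 8 * (Real.exp u / u) := by
      field_simp; ring
    rw [e]
    refine sub_le_sub_right ?_ _
    by_cases h : 2 * Z ≤ c * u
    · have : Real.exp u / u ^ 2 * ((2 * Z - c * u) / 8) ≤ 0 :=
        mul_nonpos_of_nonneg_of_nonpos (by positivity) (by linarith)
      exact this.trans (by positivity)
    · have hu' : u ≤ 2 / c * Z := by
        rw [div_mul_eq_mul_div, le_div_iff₀ hc]; linarith
      have h3 : Real.exp u / u ^ 2 ≤ Real.exp (2 / c * Z) :=
        (div_le_self (Real.exp_pos u).le (one_le_pow₀ hu)).trans (Real.exp_le_exp.2 hu')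
      have h4 : (2 * Z - c * u) / 8 ≤ Z := by
        have := mul_pos hc hu0
        linarith
      calc _ ≤ Real.exp u / u ^ 2 * Z := mul_le_mul_of_nonneg_left h4 (by positivity)
        _ ≤ Real.exp (2 / c * Z) * Z := mul_le_mul_of_nonneg_right h3 hZ.le
        _ = _ := mul_comm _ _
  have h3 : Z * Real.exp (2 / c * Z) ≤ Real.exp ((1 + 2 / c) * Z) := by
    rw [add_mul, one_mul, Real.exp_add]
    exact mul_le_mul_of_nonneg_right (by have := Real.add_one_le_exp Z; linarith)
      (Real.exp_pos _).le
  have h4 : c / 8 * (Real.exp (u / 2) / 2) ≤ c / 8 * (Real.exp u / u) :=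
    mul_le_mul_of_nonneg_left h1 (by positivity)
  linarith

/-- The drift of the exponential of the smoothed square root of the imbalance. -/
theorem drift_exp_rootPerp_le {lam : ℝ} {m : Fin n → ℝ} {γ : ℝ} (hlam : 0 < lam)
    (hm : ∀ i, 0 < m i) (hγ : 0 < γ) (hov : ∑ i, m i < lam) (x : Fin n → ℕ) {c : ℝ}
    (hc : c = 2 * (lam - ∑ i, m i) / n) :
    lam * (Real.exp (rootPerp (x + Pi.single (shortest x) 1)) - Real.exp (rootPerp x))
      + ∑ i, departure m γ x i *
          (Real.exp (rootPerp (x - Pi.single i 1)) - Real.exp (rootPerp x)) ≤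
    Real.exp ((1 + 2 / c) * (c + 4 * (lam + ∑ i, m i + γ * total x)))
      - c / 16 * Real.exp (rootPerp x / 2) := by
  have hn : (1 : ℝ) ≤ n := Nat.one_le_cast.2 (NeZero.pos n)
  have hc0 : 0 < c := by rw [hc]; exact div_pos (by linarith) (by linarith)
  set u := rootPerp x with hu
  have hu1 : 1 ≤ u := one_le_rootPerp x
  have hu0 : 0 < u := by linarith
  have hV := norm_perp_le_rootPerp_sq x
  have hninv : 1 / (n : ℝ) ≤ 1 := by rw [div_le_one (by linarith)]; exact hn
  have hninv0 : 0 ≤ 1 / (n : ℝ) := by positivity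
  have habs : ∀ i, |(x i : ℝ) - total x / n| ≤ u ^ 2 := fun i =>
    (abs_sub_le_norm_perp x i).trans hV
  have hu2 : 1 ≤ u ^ 2 := one_le_pow₀ hu1
  have h1 : ∀ i, Real.exp (rootPerp (x + Pi.single i 1)) - Real.exp u ≤
      Real.exp u * ((2 * ((x i : ℝ) - total x / n) + 1 - 1 / n) / (4 * u ^ 3)
        + 9 / (16 * u ^ 2)) := by
    intro i
    refine exp_sub_exp_le hu1 (zero_le_one.trans (one_le_rootPerp _)) ?_ ?_
    · rw [rootPerp_pow_four, hu, rootPerp_pow_four, norm_perp_sq_add_single]; ring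
    · have := abs_le.1 (habs i)
      rw [abs_le]; constructor <;> linarith [this.1, this.2]
  have h2 : ∀ i, departure m γ x i * (Real.exp (rootPerp (x - Pi.single i 1)) - Real.exp u) ≤
      departure m γ x i * (Real.exp u *
        ((-(2 * ((x i : ℝ) - total x / n)) + 1 - 1 / n) / (4 * u ^ 3) + 9 / (16 * u ^ 2))) := by
    intro i
    by_cases hi : 1 ≤ x i
    · refine mul_le_mul_of_nonneg_left ?_ (departure_nonneg hm hγ x i)
      refine exp_sub_exp_le hu1 (zero_le_one.trans (one_le_rootPerp _)) ?_ ?_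
      · rw [rootPerp_pow_four, hu, rootPerp_pow_four, norm_perp_sq_sub_single hi]; ring
      · have := abs_le.1 (habs i)
        rw [abs_le]; constructor <;> linarith [this.1, this.2]
    · simp [departure, hi]
  set Y := lam + ∑ i, m i + γ * total x with hY
  have hμ0 : 0 ≤ ∑ i, m i := Finset.sum_nonneg fun i _ => (hm i).le
  have hY0 : 0 < Y := by
    have := mul_nonneg hγ.le (total_nonneg x)
    linarith
  have hrY : lam + ∑ i, departure m γ x i ≤ Y := by
    have := sum_departure_le hm hγ x
    linarith
  have h3 := drift_norm_perp_sq_le hlam hm hγ hov x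
  rw [← hc] at h3
  have h4 := Finset.sum_le_sum fun i (_ : i ∈ Finset.univ) => h2 i
  have h5 := mul_le_mul_of_nonneg_left (h1 (shortest x)) hlam.le
  set Da := 2 * ((x (shortest x) : ℝ) - total x / n) + 1 - 1 / n with hDa
  have e4 : ∑ i, departure m γ x i * (Real.exp u *
        ((-(2 * ((x i : ℝ) - total x / n)) + 1 - 1 / n) / (4 * u ^ 3) + 9 / (16 * u ^ 2))) =
      Real.exp u * ((∑ i, departure m γ x i *
        (-(2 * ((x i : ℝ) - total x / n)) + 1 - 1 / n)) / (4 * u ^ 3)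
        + (∑ i, departure m γ x i) * (9 / (16 * u ^ 2))) := by
    rw [Finset.sum_div, Finset.sum_mul, ← Finset.sum_add_distrib, Finset.mul_sum]
    exact Finset.sum_congr rfl fun i _ => by ring
  rw [e4] at h4
  set D := ∑ i, departure m γ x i * (-(2 * ((x i : ℝ) - total x / n)) + 1 - 1 / n) with hD
  set r := ∑ i, departure m γ x i with hr
  have h6 : (lam * Da + D) / (4 * u ^ 3) + (lam + r) * (9 / (16 * u ^ 2)) ≤
      (c + 4 * Y) / (4 * u ^ 2) - c / (4 * u) := by
    have hV' := rootPerp_sq_sub_one_le x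
    have e1 : (c + 4 * Y) / (4 * u ^ 2) - c / (4 * u) -
        ((lam * Da + D) / (4 * u ^ 3) + (lam + r) * (9 / (16 * u ^ 2))) =
        (u * (c + 4 * Y) - c * u ^ 2 - (lam * Da + D) - 9 / 4 * u * (lam + r)) / (4 * u ^ 3) := by
      field_simp; ring
    -- The `4 * Y` covers `Y` from the drift of the square and `9 / 4 * Y` from second order; the
    -- extra `c` pays for `u ^ 2 - 1 ≤ ‖perp x‖`.
    have e2 : 0 ≤ u * (c + 4 * Y) - c * u ^ 2 - (lam * Da + D) - 9 / 4 * u * (lam + r) := by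
      have a1 : c * (u ^ 2 - 1) ≤ c * ‖perp x‖ := mul_le_mul_of_nonneg_left hV' hc0.le
      have a2 : c * 1 ≤ c * u := mul_le_mul_of_nonneg_left hu1 hc0.le
      have a3 : Y * 1 ≤ Y * u := mul_le_mul_of_nonneg_left hu1 hY0.le
      have a4 : u * (lam + r) ≤ u * Y := mul_le_mul_of_nonneg_left hrY hu0.le
      linarith
    have := div_nonneg e2 (show 0 ≤ 4 * u ^ 3 by positivity)
    linarith
  calc _ ≤ Real.exp u * ((lam * Da + D) / (4 * u ^ 3) + (lam + r) * (9 / (16 * u ^ 2))) := by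
        have e : Real.exp u * ((lam * Da + D) / (4 * u ^ 3) + (lam + r) * (9 / (16 * u ^ 2))) =
          lam * (Real.exp u * (Da / (4 * u ^ 3) + 9 / (16 * u ^ 2))) +
          Real.exp u * (D / (4 * u ^ 3) + r * (9 / (16 * u ^ 2))) := by ring
        rw [e]; exact add_le_add h5 h4
    _ ≤ Real.exp u * ((c + 4 * Y) / (4 * u ^ 2) - c / (4 * u)) :=
        mul_le_mul_of_nonneg_left h6 (Real.exp_pos u).le
    _ ≤ _ := exp_mul_sub_le hc0 (by linarith) hu1

/-- A bound on the exponential moment of `rootPerp`, uniform in the abandonment rate and in the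
distribution of the total service rate over the servers. -/
theorem exists_lintegral_exp_rootPerp_le (n : ℕ) [NeZero n] {lam mu : ℝ} (hmu : 0 < mu)
    (hov : mu < lam) :
    ∃ K : ℝ, 1 ≤ K ∧ ∀ (m : Fin n → ℝ) (γ : ℝ) (π : Measure (Fin n → ℕ)),
      (∀ i, 0 < m i) → ∑ i, m i = mu → 0 < γ → CTMC.IsStationary (rate lam m γ) π →
      ∫⁻ x, ENNReal.ofReal (Real.exp (rootPerp x / 2)) ∂π ≤ ENNReal.ofReal K := by
  have hlam : 0 < lam := hmu.trans hov
  have hn : (0 : ℝ) < n := Nat.cast_pos.2 (NeZero.pos n)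
  set c := 2 * (lam - mu) / n with hc
  have hc0 : 0 < c := div_pos (by linarith) hn
  set a := (1 + 2 / c) * 4 with ha
  have ha0 : 0 < a := by positivity
  set b := (1 + 2 / c) * (c + 4 * (lam + mu)) with hb
  obtain ⟨M, hM⟩ : ∃ M : ℝ → ℝ, ∀ t, M t = (1 + lam * Real.exp t) *
        Real.exp (t * ((lam * Real.exp t + 1) * Real.exp t)) := ⟨_, fun _ => rfl⟩
  have hM0 : ∀ t, 0 < M t := fun t => by rw [hM]; positivity
  set K₁ := (Real.exp b * M a + lam) / (c / 16) with hK₁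
  set K₂ := Real.exp 1 * M 1 with hK₂
  refine ⟨max 1 (max K₁ K₂), le_max_left _ _, fun m γ π hm hsum hγ hπ => ?_⟩
  have := hπ.1
  have hexp : ∀ t, 0 < t → ∫⁻ x, ENNReal.ofReal (Real.exp (t * min γ 1 * total x)) ∂π ≤
      ENNReal.ofReal (M t) := fun t ht => by
    rw [hM]; exact lintegral_exp_total_le hlam hm hγ hπ ht
  rcases le_total γ 1 with hγ1 | hγ1
  · refine le_trans ?_ (ENNReal.ofReal_le_ofReal ((le_max_left K₁ K₂).trans (le_max_right _ _)))
    have main := lintegral_le_of_drift hlam hm hγ hπ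
      -- `rootPerp` is constant along the diagonal; adding `total` makes sublevel sets finite and
      -- costs at most `lam` in drift.
      (f := fun x => Real.exp (rootPerp x) + total x)
      (g := fun x => c / 16 * Real.exp (rootPerp x / 2))
      (w := fun x => Real.exp b * Real.exp (a * min γ 1 * total x) + lam) one_pos
      (fun x => by have := Real.exp_pos (rootPerp x); linarith)
      (fun x => by positivity) (fun x => by positivity) (fun x => by
        have h1 := drift_exp_rootPerp_le hlam hm hγ (hsum ▸ hov) x (c := c) (by rw [hc, hsum])
        have h2 : ∀ i, departure m γ x i * (Real.exp (rootPerp (x - Pi.single i 1))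
            + total (x - Pi.single i 1) - (Real.exp (rootPerp x) + total x)) ≤
            departure m γ x i *
              (Real.exp (rootPerp (x - Pi.single i 1)) - Real.exp (rootPerp x)) := by
          intro i
          by_cases hi : 1 ≤ x i
          · refine mul_le_mul_of_nonneg_left ?_ (departure_nonneg hm hγ x i)
            rw [total_sub_single hi]; linarith
          · simp [departure, hi]
        have h3 := Finset.sum_le_sum fun i (_ : i ∈ Finset.univ) => h2 i
        have h4 : Real.exp b * Real.exp (a * min γ 1 * total x) =
            Real.exp ((1 + 2 / c) * (c + 4 * (lam + ∑ i, m i + γ * total x))) := by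
          rw [← Real.exp_add, min_eq_left hγ1, hsum, ha, hb]; congr 1; ring
        rw [h4, total_add_single]
        linarith)
    simp_rw [ENNReal.ofReal_mul (show 0 ≤ c / 16 by positivity)] at main
    rw [lintegral_const_mul' _ _ ENNReal.ofReal_ne_top] at main
    rw [hK₁, ENNReal.ofReal_div_of_pos (by positivity), ENNReal.le_div_iff_mul_le
      (Or.inl (by simpa using hc0)) (Or.inl ENNReal.ofReal_ne_top), mul_comm]
    refine main.trans ?_
    rw [ENNReal.ofReal_add (mul_nonneg (Real.exp_pos b).le (hM0 a).le) hlam.le,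
      ENNReal.ofReal_mul (Real.exp_pos b).le]
    simp_rw [fun x : Fin n → ℕ => ENNReal.ofReal_add (mul_nonneg (Real.exp_pos b).le
      (Real.exp_pos (a * min γ 1 * total x)).le) hlam.le, ENNReal.ofReal_mul (Real.exp_pos b).le]
    rw [lintegral_add_right _ measurable_const, lintegral_const, measure_univ, mul_one,
      lintegral_const_mul' _ _ ENNReal.ofReal_ne_top]
    gcongr
    exact hexp a ha0
  · refine le_trans ?_ (ENNReal.ofReal_le_ofReal ((le_max_right K₁ K₂).trans (le_max_right _ _)))
    rw [hK₂, ENNReal.ofReal_mul (Real.exp_pos 1).le]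
    refine le_trans ?_ (mul_le_mul_right (hexp 1 one_pos) _)
    rw [← lintegral_const_mul' _ _ ENNReal.ofReal_ne_top]
    refine lintegral_mono fun x => ?_
    rw [← ENNReal.ofReal_mul (Real.exp_pos 1).le, ← Real.exp_add, min_eq_right hγ1]
    refine ENNReal.ofReal_le_ofReal (Real.exp_le_exp.2 ?_)
    -- Here `u ^ 2 ≤ 1 + total x`, hence `u / 2 ≤ 1 + total x`.
    have h1 := rootPerp_sq_sub_one_le x
    have h2 := norm_perp_le_total x
    nlinarith [sq_nonneg (rootPerp x - 1), total_nonneg x]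

end JSQ

/-! ### Moments of every order. -/

theorem theorem4p4 (n : ℕ) [NeZero n] (lam mu : ℝ) (hlam : 0 < lam) (hmu : 0 < mu) :
    ∃ E₁ E₂ E : ℝ, 0 < E₁ ∧ 0 < E₂ ∧ 0 < E ∧
      ∀ (m : Fin n → ℝ) (γ C α : ℝ) (π : MeasureTheory.Measure (Fin n → ℕ)),
        (∀ i, 0 < m i) → ∑ i, m i = mu → 0 < γ →
        JSQ.HeavilyOverloaded C α lam mu γ →
        CTMC.IsStationary (JSQ.rate lam m γ) π →
        ∀ p : ℝ, 1 ≤ p →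
          MeasureTheory.Integrable (fun q => ‖JSQ.perp q‖ ^ p) π ∧
          (∫ q, ‖JSQ.perp q‖ ^ p ∂π) ^ (1 / p) ≤ max (E₁ * p ^ 2) (E₂ * p) ∧
          max (E₁ * p ^ 2) (E₂ * p) ≤ E * p ^ 2 := by
  by_cases hov : mu < lam
  · obtain ⟨K, hK1, hK⟩ := JSQ.exists_lintegral_exp_rootPerp_le n hmu hov
    have hK0 : 0 < K := by linarith
    refine ⟨16 * K, 16 * K, 16 * K, by positivity, by positivity, by positivity,
      fun m γ C α π hm hsum hγ _ hπ p hp => ?_⟩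
    have := hπ.1
    have hp0 : 0 < p := by linarith
    have hle := hK m γ π hm hsum hγ hπ
    have hint : Integrable (fun x => Real.exp (JSQ.rootPerp x / 2)) π := by
      refine ⟨(measurable_of_countable _).aestronglyMeasurable, ?_⟩
      rw [hasFiniteIntegral_iff_ofReal (Filter.Eventually.of_forall fun x => (Real.exp_pos _).le)]
      exact hle.trans_lt ENNReal.ofReal_lt_top
    have hmean : ∫ x, Real.exp (JSQ.rootPerp x / 2) ∂π ≤ K := by
      rw [integral_eq_lintegral_of_nonneg_ae
        (Filter.Eventually.of_forall fun x => (Real.exp_pos _).le) hint.1]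
      exact ENNReal.toReal_le_of_le_ofReal hK0.le hle
    have hV : Integrable (fun q => ‖JSQ.perp q‖ ^ p) π := by
      refine (hint.const_mul ((16 * p ^ 2) ^ p)).mono'
        (measurable_of_countable _).aestronglyMeasurable (Filter.Eventually.of_forall fun x => ?_)
      rw [Real.norm_of_nonneg (Real.rpow_nonneg (norm_nonneg _) p)]
      exact JSQ.norm_perp_rpow_le x hp
    refine ⟨hV, le_max_of_le_left ?_, max_le le_rfl ?_⟩
    · have h1 : ∫ q, ‖JSQ.perp q‖ ^ p ∂π ≤ (16 * p ^ 2) ^ p * K := by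
        refine (integral_mono hV (hint.const_mul ((16 * p ^ 2) ^ p))
          fun x => JSQ.norm_perp_rpow_le x hp).trans ?_
        rw [integral_const_mul]
        exact mul_le_mul_of_nonneg_left hmean (by positivity)
      calc (∫ q, ‖JSQ.perp q‖ ^ p ∂π) ^ (1 / p)
          ≤ ((16 * p ^ 2) ^ p * K) ^ (1 / p) :=
            Real.rpow_le_rpow (integral_nonneg fun x => Real.rpow_nonneg (norm_nonneg _) p) h1
              (by positivity)
        _ = 16 * p ^ 2 * K ^ (1 / p) := by
            rw [Real.mul_rpow (by positivity) hK0.le, ← Real.rpow_mul (by positivity),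
              mul_one_div_cancel hp0.ne', Real.rpow_one]
        -- `1 ≤ K` is what removes the dependence on `p`.
        _ ≤ 16 * p ^ 2 * K ^ (1 : ℝ) := by
            refine mul_le_mul_of_nonneg_left
              (Real.rpow_le_rpow_of_exponent_le hK1 ?_) (by positivity)
            rw [div_le_one hp0]; exact hp
        _ = 16 * K * p ^ 2 := by rw [Real.rpow_one]; ring
    · refine mul_le_mul_of_nonneg_left ?_ (by positivity)
      nlinarith
  -- Heavy overload forces `mu < lam`, so this case is vacuous and the constants are arbitrary.
  · refine ⟨1, 1, 1, one_pos, one_pos, one_pos, fun m γ C α π hm hsum hγ h hπ p hp => ?_⟩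
    obtain ⟨hC, -, -, hle⟩ := h
    have h1 : 0 < C * (γ / mu) ^ α :=
      mul_pos (by linarith) (Real.rpow_pos_of_pos (div_pos hγ hmu) α)
    have h2 : 1 < lam / mu := by linarith
    exact absurd ((one_lt_div hmu).1 h2) hov
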